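/- Let $S$ be a finite set of servers, each server $s$ having a positive integer capacity $u(s)$. Clients arrive one at a time, each together with all its edges to $S$, and $n$ denotes the total number of clients that arrive. An assignment gives each arrived client at most one adjacent server, with at most $u(s)$ clients on each server $s$; initially it is empty. An augmenting path from an unassigned client $c$ is a path in the current bipartite graph (without repeated vertices) which starts at $c$, whose edges lie alternately outside and inside the assignment, beginning and ending with an edge outside it, and which ends at a server $s$ that currently has fewer than $u(s)$ clients assigned. The SAP protocol does the following when a client $c$ arrives: it picks a shortest augmenting path from $c$ (breaking ties arbitrarily) and flips the status (in or out of the assignment) of every edge on it; if no augmenting path from $c$ exists, it does nothing. A reassignment is a change of the server of an already assigned client. Then SAP makes $O(n\log^2 n)$ reassignments in total: there is an absolute constant $K$ such that, for every such instance, every arrival order and every way of breaking ties, the total number of reassignments over all $n$ arrivals is at most $K\,n\log^2 n$. -/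

import Mathlib

namespace CapacitatedAssignment

/-- A (partial) assignment of clients to servers: `A c = some s` means that the edge `(c, s)`
is in the current assignment, `A c = none` that client `c` is currently not served. -/
abbrev Assignment (C S : Type*) := C → Option S

section

variable {C S : Type*} [Fintype C]

open Classical in
/-- The number of clients currently assigned to the server `s`. -/
noncomputable def load (A : Assignment C S) (s : S) : ℕ :=
  (Finset.univ.filter fun c => A c = some s).card

/-- In the bipartite graph with edge relation `E` and server capacities `u`, the vertices
`p 0, q 0, p 1, q 1, …, p k, q k` form an augmenting path of length `2 * k + 1` from the
client `c` with respect to the assignment `A`: a path in the graph without repeated vertices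
that starts in the unassigned client `c`, alternates between edges outside and inside the
assignment, and ends in a server that currently has less than its capacity of clients. -/
structure IsAugmentingPath (E : C → S → Prop) (u : S → ℕ) (A : Assignment C S) (c : C)
    (k : ℕ) (p : Fin (k + 1) → C) (q : Fin (k + 1) → S) : Prop where
  start : p 0 = c
  start_unassigned : A c = none
  clients_injective : Function.Injective p
  servers_injective : Function.Injective q
  edge : ∀ i, E (p i) (q i)
  unmatched_edge : ∀ i, A (p i) ≠ some (q i)
  matched_edge : ∀ i : Fin k, A (p i.succ) = some (q i.castSucc)
  end_free : load A (q (Fin.last k)) < u (q (Fin.last k))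

/-- `A'` is obtained from `A` by flipping every edge of the path `p 0, q 0, …, p k, q k`. -/
def IsFlip (A A' : Assignment C S) {k : ℕ} (p : Fin (k + 1) → C) (q : Fin (k + 1) → S) : Prop :=
  (∀ i, A' (p i) = some (q i)) ∧ ∀ c, c ∉ Set.range p → A' c = A c

/-- One step of the shortest augmenting path protocol, on arrival of the client `c`: augment down
some shortest augmenting path from `c` (ties are broken arbitrarily); if there is no
augmenting path from `c`, do nothing. -/
def SAPStep (E : C → S → Prop) (u : S → ℕ) (c : C) (A A' : Assignment C S) : Prop :=
  (∃ (k : ℕ) (p : Fin (k + 1) → C) (q : Fin (k + 1) → S),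
      IsAugmentingPath E u A c k p q ∧
      (∀ (k' : ℕ) (p' : Fin (k' + 1) → C) (q' : Fin (k' + 1) → S),
        IsAugmentingPath E u A c k' p' q' → k ≤ k') ∧
      IsFlip A A' p q) ∨
  ((¬ ∃ (k : ℕ) (p : Fin (k + 1) → C) (q : Fin (k + 1) → S), IsAugmentingPath E u A c k p q) ∧
    A' = A)

end

section

variable {n : ℕ} {S : Type*}

/-- `A 0, A 1, …, A n` are the successive assignments of a run of the shortest augmenting path
protocol in which the clients arrive in the order `0, 1, …, n - 1`; `A t` is the assignment after
`t` clients have arrived. Clients that have not arrived yet are unassigned, and the interior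
clients of an augmenting path are assigned, so no path uses a client that is yet to arrive. -/
structure IsSAPRun (E : Fin n → S → Prop) (u : S → ℕ)
    (A : Fin (n + 1) → Assignment (Fin n) S) : Prop where
  init : ∀ c, A 0 c = none
  step : ∀ t : Fin n, SAPStep E u t (A t.castSucc) (A t.succ)

open Classical in
/-- The total number of reassignments: pairs of an arrival `t` and a client `c` that was served
before the arrival and whose server is changed at this arrival. -/
noncomputable def reassignments (A : Fin (n + 1) → Assignment (Fin n) S) : ℕ :=
  ∑ t : Fin n,
    (Finset.univ.filter fun c => A t.castSucc c ≠ none ∧ A t.succ c ≠ A t.castSucc c).card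

end

end CapacitatedAssignment

namespace CapacitatedAssignment

/-! ### Neighbourhoods and feasible assignments. -/

section

variable {C S : Type*}

/-! For `0 ≤ a ≤ 1`, the potential is the maximum over sets `X` of served clients of `|X| - a *
u(N(X))`. Serving all of `X` forces `|X| ≤ u(N(X))`, so the potential never exceeds `(1 - a) * n`;
it never decreases, since served clients stay served. Let `X` be a maximizer. Disjoint sets of
served clients expand outside `N(X)` by a factor `1 / a`. If the shortest augmenting path of an
arriving client has more than `h` matched edges and the client has a neighbour outside `N(X)`, then
breadth-first search outside `N(X)` meets only full servers for `h` rounds and reaches at least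
`a⁻ʰ` clients, too many once `a ^ h * (n - 1) < 1` (`neighbor_of_forall_le_length`). Hence all its
neighbours lie in `N(X)`, and adding it to `X` raises the potential by 1 (`maxSurplus_insert`). So
at most `(1 - a) * n` arrivals have such long paths. With `a = 1 - log n / h` this is `n * log n /
h`, and summing over `h` gives the second logarithm (`sum_le_of_card_le`). -/

open Classical in
/-- The servers adjacent to at least one client of `X`. -/
noncomputable def neighbors [Fintype S] (E : C → S → Prop) (X : Finset C) : Finset S :=
  Finset.univ.filter fun s => ∃ c ∈ X, E c s

open Classical in
/-- The clients that are served by a server of `T`. -/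
noncomputable def servedBy [Fintype C] (A : Assignment C S) (T : Finset S) : Finset C :=
  Finset.univ.filter fun c => ∃ s ∈ T, A c = some s

open Classical in
/-- The clients that are served. -/
noncomputable def served [Fintype C] (A : Assignment C S) : Finset C :=
  Finset.univ.filter fun c => A c ≠ none

/-- An assignment along edges of the graph that respects the capacities. -/
structure IsFeasible [Fintype C] (E : C → S → Prop) (u : S → ℕ) (A : Assignment C S) : Prop where
  edge : ∀ c s, A c = some s → E c s
  load_le : ∀ s, load A s ≤ u s

theorem card_servedBy [Fintype C] (A : Assignment C S) (T : Finset S) :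
    (servedBy A T).card = ∑ s ∈ T, load A s := by
  classical
  have h : servedBy A T = T.biUnion fun s => Finset.univ.filter fun c => A c = some s := by
    ext c
    simp [servedBy]
  rw [h, Finset.card_biUnion]
  · unfold load
    refine Finset.sum_congr rfl fun s _ => ?_
    congr
  · intro s _ s' _ hne
    refine Finset.disjoint_left.2 fun c hc hc' => hne ?_
    simp only [Finset.mem_filter, Finset.mem_univ, true_and] at hc hc'
    simpa [hc] using hc'

/-! ### Alternating walks and augmenting paths. -/

/-- The servers outside `N` at the end of an alternating walk from `c` with `i` assigned edges
that visits only servers outside `N`. -/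
def reach (E : C → S → Prop) (A : Assignment C S) (N : Finset S) (c : C) : ℕ → Set S
  | 0 => {s | s ∉ N ∧ E c s}
  | i + 1 => {s | s ∉ N ∧ ∃ d, E d s ∧ ∃ s' ∈ reach E A N c i, A d = some s'}

/-- First arrival at `s` forces first arrival at every earlier server of the walk. The last clause
records this; it makes the servers distinct. -/
theorem exists_walk_of_mem_reach {E : C → S → Prop} {A : Assignment C S} {N : Finset S} {c : C} :
    ∀ (i : ℕ) (s : S), s ∈ reach E A N c i → (∀ j < i, s ∉ reach E A N c j) →
      ∃ (p : ℕ → C) (q : ℕ → S), p 0 = c ∧ q i = s ∧ (∀ j ≤ i, E (p j) (q j)) ∧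
        (∀ j < i, A (p (j + 1)) = some (q j)) ∧
        ∀ j ≤ i, q j ∈ reach E A N c j ∧ ∀ l < j, q j ∉ reach E A N c l := by
  intro i
  induction i with
  | zero =>
    intro s hs _
    refine ⟨fun _ => c, fun _ => s, rfl, rfl, fun _ _ => hs.2, fun j hj => by omega, ?_⟩
    intro j hj
    obtain rfl : j = 0 := by omega
    exact ⟨hs, fun l hl => by omega⟩
  | succ i ih =>
    intro s hs hmin
    obtain ⟨hN, d, hd, s', hs', hA⟩ := id hs
    obtain ⟨p, q, h0, hi, hE, hM, hR⟩ := ih s' hs' fun j hj hj' =>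
      hmin (j + 1) (by omega) ⟨hN, d, hd, s', hj', hA⟩
    refine ⟨fun j => if j ≤ i then p j else d, fun j => if j ≤ i then q j else s,
      by simpa using h0, by simp, ?_, ?_, ?_⟩
    · intro j hj
      by_cases h : j ≤ i
      · simpa [h] using hE j h
      · simpa [h] using hd
    · intro j hj
      by_cases h : j + 1 ≤ i
      · simpa [h, (by omega : j ≤ i)] using hM j (by omega)
      · obtain rfl : j = i := by omega
        simpa [hi] using hA
    · intro j hj
      by_cases h : j ≤ i
      · simpa [h] using hR j h
      · obtain rfl : j = i + 1 := by omega
        simpa [Nat.lt_succ_iff] using ⟨hs, fun l hl => hmin l (by omega)⟩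

theorem exists_isAugmentingPath_of_mem_reach [Fintype C] {E : C → S → Prop} {u : S → ℕ} {A : Assignment C S}
    {N : Finset S} {c : C} (hc : A c = none) {i : ℕ} {s : S} (hs : s ∈ reach E A N c i)
    (hfree : load A s < u s) :
    ∃ k ≤ i, ∃ (p : Fin (k + 1) → C) (q : Fin (k + 1) → S), IsAugmentingPath E u A c k p q := by
  classical
  have hex : ∃ j, s ∈ reach E A N c j := ⟨i, hs⟩
  obtain ⟨p, q, h0, hk, hE, hM, hR⟩ := exists_walk_of_mem_reach (Nat.find hex) s
    (Nat.find_spec hex) fun j hj => Nat.find_min hex hj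
  have hle : Nat.find hex ≤ i := Nat.find_min' hex hs
  generalize Nat.find hex = k at hk hE hM hR hle
  have hq : ∀ a ≤ k, ∀ b ≤ k, q a = q b → a = b := by
    intro a ha b hb hab
    rcases lt_trichotomy a b with h | h | h
    · exact absurd (hab ▸ (hR a ha).1) ((hR b hb).2 a h)
    · exact h
    · exact absurd (hab ▸ (hR b hb).1) ((hR a ha).2 b h)
  refine ⟨k, hle, fun j => p j, fun j => q j, ?_⟩
  refine ⟨by simpa using h0, hc, ?_, ?_, fun j => hE j (by omega), ?_, ?_, by simpa [hk] using hfree⟩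
  -- Each later client is assigned to the preceding server and `c` is unassigned, so distinct
  -- servers give distinct clients.
  · rintro ⟨a, ha⟩ ⟨b, hb⟩ hab
    simp only at hab
    rw [Fin.mk.injEq]
    cases a with
    | zero =>
      cases b with
      | zero => rfl
      | succ b =>
        have := hM b (by omega)
        rw [← hab, h0, hc] at this
        simp at this
    | succ a =>
      cases b with
      | zero =>
        have := hM a (by omega)
        rw [hab, h0, hc] at this
        simp at this
      | succ b =>
        have h1 := hM a (by omega)
        rw [hab, hM b (by omega), Option.some_inj] at h1
        rw [hq b (by omega) a (by omega) h1]
  · rintro ⟨a, ha⟩ ⟨b, hb⟩ hab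
    rw [Fin.mk.injEq]
    exact hq a (by omega) b (by omega) hab
  · rintro ⟨a, ha⟩ hab
    simp only at hab
    cases a with
    | zero => rw [h0, hc] at hab; simp at hab
    | succ a =>
      rw [hM a (by omega), Option.some_inj] at hab
      have := hq _ (by omega) _ (by omega) hab
      omega
  · intro j
    simpa using hM j j.2

/-! ### The surplus potential and expansion. -/

/-- By how much the number of clients in `X` exceeds the capacity of its neighbourhood, scaled
down by the factor `a`. -/
noncomputable def surplus [Fintype S] (E : C → S → Prop) (u : S → ℕ) (a : ℝ) (X : Finset C) : ℝ :=
  X.card - a * ∑ s ∈ neighbors E X, (u s : ℝ)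

/-- The largest surplus of a set of clients in `M`. -/
noncomputable def maxSurplus [Fintype S] (E : C → S → Prop) (u : S → ℕ) (a : ℝ) (M : Finset C) : ℝ :=
  M.powerset.sup' ⟨∅, Finset.empty_mem_powerset M⟩ (surplus E u a)

theorem surplus_le_maxSurplus [Fintype S] (E : C → S → Prop) (u : S → ℕ) (a : ℝ) {X M : Finset C}
    (h : X ⊆ M) : surplus E u a X ≤ maxSurplus E u a M :=
  Finset.le_sup' (surplus E u a) (Finset.mem_powerset.2 h)

theorem exists_surplus_eq_maxSurplus [Fintype S] (E : C → S → Prop) (u : S → ℕ) (a : ℝ) (M : Finset C) :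
    ∃ X ⊆ M, surplus E u a X = maxSurplus E u a M := by
  obtain ⟨X, hX, h⟩ := Finset.exists_mem_eq_sup' ⟨∅, Finset.empty_mem_powerset M⟩ (surplus E u a)
  exact ⟨X, Finset.mem_powerset.1 hX, h.symm⟩

theorem maxSurplus_mono [Fintype S] (E : C → S → Prop) (u : S → ℕ) (a : ℝ) {M M' : Finset C} (h : M ⊆ M') :
    maxSurplus E u a M ≤ maxSurplus E u a M' := by
  obtain ⟨X, hX, he⟩ := exists_surplus_eq_maxSurplus E u a M
  exact he ▸ surplus_le_maxSurplus E u a (hX.trans h)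

theorem maxSurplus_nonneg [Fintype S] (E : C → S → Prop) (u : S → ℕ) (a : ℝ) (M : Finset C) :
    0 ≤ maxSurplus E u a M := by
  simpa [surplus, neighbors] using surplus_le_maxSurplus E u a (Finset.empty_subset M)

/-- The easy direction of Hall's condition: served clients fit into the capacity of their
neighbourhood. -/
theorem IsFeasible.maxSurplus_le [Fintype C] [Fintype S] {E : C → S → Prop} {u : S → ℕ} {A : Assignment C S}
    (hA : IsFeasible E u A) {a : ℝ} (ha : 0 ≤ a) (ha' : a ≤ 1) :
    maxSurplus E u a (served A) ≤ (1 - a) * Fintype.card C := by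
  classical
  obtain ⟨X, hX, he⟩ := exists_surplus_eq_maxSurplus E u a (served A)
  have h1 : X ⊆ servedBy A (neighbors E X) := by
    intro c hc
    have := hX hc
    simp only [served, Finset.mem_filter, Finset.mem_univ, true_and] at this
    obtain ⟨s, hs⟩ := Option.ne_none_iff_exists'.1 this
    simp only [servedBy, neighbors, Finset.mem_filter, Finset.mem_univ, true_and]
    exact ⟨s, ⟨c, hc, hA.edge c s hs⟩, hs⟩
  have h2 : X.card ≤ ∑ s ∈ neighbors E X, u s :=
    (Finset.card_le_card h1).trans
      ((card_servedBy A _).trans_le (Finset.sum_le_sum fun s _ => hA.load_le s))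
  have h3 : (X.card : ℝ) ≤ ∑ s ∈ neighbors E X, (u s : ℝ) := by exact_mod_cast h2
  have h4 : (X.card : ℝ) ≤ Fintype.card C := by exact_mod_cast Finset.card_le_univ X
  rw [← he, surplus]
  nlinarith [mul_le_mul_of_nonneg_left h3 ha, mul_le_mul_of_nonneg_left h4 (sub_nonneg.2 ha')]

open Classical in
/-- Clients outside a set of maximal surplus expand outside its neighbourhood. -/
theorem card_le_of_surplus_eq_maxSurplus [Fintype S] {E : C → S → Prop} {u : S → ℕ} {a : ℝ}
    {M X Y : Finset C} (hX : X ⊆ M) (hmax : surplus E u a X = maxSurplus E u a M) (hY : Y ⊆ M)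
    (hXY : Disjoint X Y) :
    (Y.card : ℝ) ≤ a * ∑ s ∈ neighbors E Y \ neighbors E X, (u s : ℝ) := by
  have h := surplus_le_maxSurplus E u a (Finset.union_subset hX hY)
  have hN : neighbors E (X ∪ Y) = neighbors E X ∪ (neighbors E Y \ neighbors E X) := by
    ext s
    simp only [neighbors, Finset.mem_filter, Finset.mem_univ, true_and, Finset.mem_union,
      Finset.mem_sdiff, or_and_right, exists_or]
    by_cases hs : ∃ c ∈ X, E c s <;> simp [hs]
  rw [← hmax, surplus, surplus, hN, Finset.sum_union Finset.disjoint_sdiff,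
    Finset.card_union_of_disjoint hXY] at h
  push_cast at h
  linarith

/-- A neighbour outside `neighbors E X` would start a search whose layers stay full up to index `h`
and grow geometrically, outnumbering the available clients. -/
theorem neighbor_of_forall_le_length [Fintype C] [Fintype S] {E : C → S → Prop} {u : S → ℕ} {A : Assignment C S}
    (hu : ∀ s, 0 < u s) (hA : IsFeasible E u A) {a : ℝ} (ha : 0 ≤ a) {X : Finset C}
    (hX : X ⊆ served A) (hmax : surplus E u a X = maxSurplus E u a (served A)) {c : C}
    (hc : A c = none) {h : ℕ}
    (hlong : ∀ (k : ℕ) (p : Fin (k + 1) → C) (q : Fin (k + 1) → S),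
      IsAugmentingPath E u A c k p q → h < k)
    (hsmall : a ^ h * ((Fintype.card C : ℝ) - 1) < 1) {s : S} (hs : E c s) :
    s ∈ neighbors E X := by
  classical
  by_contra hsX
  set T : ℕ → Finset S := fun i =>
    Finset.univ.filter fun s => s ∈ reach E A (neighbors E X) c i with hT
  have hsat : ∀ i ≤ h, ∀ t ∈ T i, load A t = u t := by
    intro i hi t ht
    refine le_antisymm (hA.load_le t) (not_lt.1 fun hlt => ?_)
    obtain ⟨k, hk, p, q, hpq⟩ := exists_isAugmentingPath_of_mem_reach hc
      (Finset.mem_filter.1 ht).2 hlt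
    have := hlong k p q hpq
    omega
  have hcard : ∀ i ≤ h, ∑ t ∈ T i, (u t : ℝ) = (servedBy A (T i)).card := by
    intro i hi
    rw [card_servedBy, Finset.sum_congr rfl (hsat i hi)]
    push_cast
    rfl
  have hTN : ∀ i, ∀ t ∈ T i, t ∉ neighbors E X := by
    intro i t ht
    have := (Finset.mem_filter.1 ht).2
    cases i <;> exact this.1
  have hserved : ∀ i, servedBy A (T i) ⊆ served A := by
    intro i d hd
    simp only [servedBy, served, Finset.mem_filter, Finset.mem_univ, true_and] at hd ⊢
    obtain ⟨t, _, ht⟩ := hd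
    simp [ht]
  have hstep : ∀ i ≤ h, ∑ t ∈ T i, (u t : ℝ) ≤ a * ∑ t ∈ T (i + 1), (u t : ℝ) := by
    intro i hi
    have hdisj : Disjoint X (servedBy A (T i)) := by
      refine Finset.disjoint_left.2 fun d hdX hd => ?_
      simp only [servedBy, Finset.mem_filter, Finset.mem_univ, true_and] at hd
      obtain ⟨t, ht, hdt⟩ := hd
      refine hTN i t ht ?_
      simp only [neighbors, Finset.mem_filter, Finset.mem_univ, true_and]
      exact ⟨d, hdX, hA.edge d t hdt⟩
    rw [hcard i hi]
    refine (card_le_of_surplus_eq_maxSurplus hX hmax (hserved i) hdisj).trans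
      (mul_le_mul_of_nonneg_left ?_ ha)
    refine Finset.sum_le_sum_of_subset_of_nonneg ?_ fun t _ _ => Nat.cast_nonneg _
    intro t ht
    rw [Finset.mem_sdiff] at ht
    obtain ⟨ht, htN⟩ := ht
    simp only [neighbors, servedBy, Finset.mem_filter, Finset.mem_univ, true_and] at ht
    obtain ⟨d, ⟨s', hs', hd⟩, hdt⟩ := ht
    exact Finset.mem_filter.2
      ⟨Finset.mem_univ _, htN, d, hdt, s', (Finset.mem_filter.1 hs').2, hd⟩
  have hgrow : ∀ i ≤ h, 1 ≤ a ^ i * ∑ t ∈ T i, (u t : ℝ) := by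
    intro i
    induction i with
    | zero =>
      intro _
      have h0 : s ∈ T 0 := Finset.mem_filter.2 ⟨Finset.mem_univ _, hsX, hs⟩
      have h1 : (u s : ℝ) ≤ ∑ t ∈ T 0, (u t : ℝ) :=
        Finset.single_le_sum (f := fun t => (u t : ℝ)) (fun t _ => Nat.cast_nonneg _) h0
      have h2 : (1 : ℝ) ≤ u s := by exact_mod_cast hu s
      rw [pow_zero, one_mul]
      exact h2.trans h1
    | succ i ih =>
      intro hi
      calc 1 ≤ a ^ i * ∑ t ∈ T i, (u t : ℝ) := ih (by omega)
        _ ≤ a ^ i * (a * ∑ t ∈ T (i + 1), (u t : ℝ)) :=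
          mul_le_mul_of_nonneg_left (hstep i (by omega)) (pow_nonneg ha i)
        _ = _ := by ring
  -- The client `c` is itself unserved, whence the `- 1` in `hsmall`.
  have hlt : (servedBy A (T h)).card + 1 ≤ Fintype.card C := by
    refine Finset.card_lt_univ_of_notMem (x := c) ?_
    intro hcm
    have := hserved h hcm
    simp [served, hc] at this
  have hlt' : ((servedBy A (T h)).card : ℝ) ≤ Fintype.card C - 1 := by
    rw [le_sub_iff_add_le]
    exact_mod_cast hlt
  have := hgrow h le_rfl
  rw [hcard h le_rfl] at this
  linarith [mul_le_mul_of_nonneg_left hlt' (pow_nonneg ha h)]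

/-- Adding `c` to the maximizer `X` costs no new capacity. -/
theorem maxSurplus_insert [Fintype S] {E : C → S → Prop} {u : S → ℕ} {a : ℝ} {M X : Finset C}
    (hX : X ⊆ M) (hmax : surplus E u a X = maxSurplus E u a M) {c : C} (hc : c ∉ M)
    (hN : ∀ s, E c s → s ∈ neighbors E X) {M' : Finset C} (hM : M ⊆ M') (hcM : c ∈ M') :
    maxSurplus E u a M + 1 ≤ maxSurplus E u a M' := by
  classical
  refine le_trans (le_of_eq ?_)
    (surplus_le_maxSurplus E u a (X := insert c X) (Finset.insert_subset hcM (hX.trans hM)))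
  have h : neighbors E (insert c X) = neighbors E X := by
    ext s
    have := hN s
    simp only [neighbors, Finset.mem_filter, Finset.mem_univ, true_and,
      Finset.exists_mem_insert] at this ⊢
    tauto
  rw [← hmax, surplus, surplus, h, Finset.card_insert_of_notMem fun h => hc (hX h)]
  push_cast
  ring

/-! ### The effect of one step of the protocol. -/

namespace IsAugmentingPath

variable [Fintype C] {E : C → S → Prop} {u : S → ℕ} {A A' : Assignment C S} {c : C} {k : ℕ}
  {p : Fin (k + 1) → C} {q : Fin (k + 1) → S}

theorem lt_card (h : IsAugmentingPath E u A c k p q) : k < Fintype.card C := by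
  have := Fintype.card_le_of_injective p h.clients_injective
  simpa using this

theorem served_subset (hf : IsFlip A A' p q) : served A ⊆ served A' := by
  intro d hd
  simp only [served, Finset.mem_filter, Finset.mem_univ, true_and] at hd ⊢
  by_cases hp : d ∈ Set.range p
  · obtain ⟨i, rfl⟩ := hp
    simp [hf.1 i]
  · rwa [hf.2 d hp]

theorem mem_served (h : IsAugmentingPath E u A c k p q) (hf : IsFlip A A' p q) :
    c ∈ served A' := by
  simp [served, ← h.start, hf.1 0]

theorem isFeasible (h : IsAugmentingPath E u A c k p q) (hf : IsFlip A A' p q)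
    (hA : IsFeasible E u A) : IsFeasible E u A' := by
  classical
  refine ⟨fun d s hd => ?_, fun s => ?_⟩
  · by_cases hp : d ∈ Set.range p
    · obtain ⟨i, rfl⟩ := hp
      rw [hf.1 i, Option.some_inj] at hd
      exact hd ▸ h.edge i
    · exact hA.edge d s (hf.2 d hp ▸ hd)
  · have key : ∀ d, A' d = some s → A d = some s ∨ ∃ i, d = p i ∧ s = q i := by
      intro d hd
      by_cases hp : d ∈ Set.range p
      · obtain ⟨i, rfl⟩ := hp
        rw [hf.1 i, Option.some_inj] at hd
        exact Or.inr ⟨i, rfl, hd.symm⟩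
      · exact Or.inl (hf.2 d hp ▸ hd)
    by_cases hs : s ∈ Set.range q
    · obtain ⟨i, rfl⟩ := hs
      have key' : ∀ d, A' d = some (q i) → d = p i ∨ A d = some (q i) := by
        intro d hd
        rcases key d hd with h1 | ⟨j, h1, h2⟩
        · exact Or.inr h1
        · rw [h.servers_injective h2]
          exact Or.inl h1
      -- The last server gains one client and had room for it; any other server on the path trades
      -- `p i.succ` for `p i.castSucc`.
      induction i using Fin.lastCases with
      | last =>
        refine le_trans ?_ (Nat.succ_le_of_lt h.end_free)
        unfold load
        refine le_trans (Finset.card_le_card ?_) (Finset.card_insert_le (p (Fin.last k)) _)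
        intro d hd
        simpa using key' d (by simpa using hd)
      | cast i =>
        refine le_trans ?_ (hA.load_le _)
        unfold load
        have hmem : p i.succ ∈ Finset.univ.filter fun d => A d = some (q i.castSucc) := by
          simpa using h.matched_edge i
        rw [← Finset.card_erase_add_one hmem]
        refine le_trans (Finset.card_le_card ?_) (Finset.card_insert_le (p i.castSucc) _)
        intro d hd
        have hd' : A' d = some (q i.castSucc) := by simpa using hd
        rw [Finset.mem_insert, Finset.mem_erase]
        refine (key' d hd').imp_right fun h1 => ⟨?_, by simpa using h1⟩
        rintro rfl
        rw [hf.1, Option.some_inj] at hd'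
        exact absurd (h.servers_injective hd') (by simp [Fin.ext_iff])
    · refine le_trans (Finset.card_le_card ?_) (hA.load_le s)
      intro d hd
      rcases key d (by simpa using hd) with h1 | ⟨j, _, h2⟩
      · simpa using h1
      · exact absurd ⟨j, h2.symm⟩ hs

open Classical in
theorem card_reassigned_le (h : IsAugmentingPath E u A c k p q) (hf : IsFlip A A' p q) :
    (Finset.univ.filter fun d => A d ≠ none ∧ A' d ≠ A d).card ≤ k := by
  have hsub : (Finset.univ.filter fun d => A d ≠ none ∧ A' d ≠ A d) ⊆
      Finset.univ.image fun i : Fin k => p i.succ := by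
    intro d hd
    simp only [Finset.mem_filter, Finset.mem_univ, true_and] at hd
    have hp : d ∈ Set.range p := by
      by_contra hp
      exact hd.2 (hf.2 d hp)
    obtain ⟨i, rfl⟩ := hp
    cases i using Fin.cases with
    | zero => exact absurd (h.start ▸ h.start_unassigned) hd.1
    | succ i => simp
  refine (Finset.card_le_card hsub).trans (Finset.card_image_le.trans ?_)
  simp

end IsAugmentingPath

open Classical in
/-- A step of the protocol makes at most `k` reassignments, where `k` can be chosen such that a
large value of `k` forces the maximal surplus to grow. -/
theorem SAPStep.exists_length [Fintype C] [Fintype S] {E : C → S → Prop} {u : S → ℕ} {c : C} {A A' : Assignment C S}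
    (hu : ∀ s, 0 < u s) (hA : IsFeasible E u A) (hstep : SAPStep E u c A A') :
    IsFeasible E u A' ∧ ∃ k : ℕ, (k = 0 ∨ k < Fintype.card C) ∧
      (Finset.univ.filter fun d => A d ≠ none ∧ A' d ≠ A d).card ≤ k ∧
      ∀ (a : ℝ) (h : ℕ), 0 ≤ a → a ^ h * ((Fintype.card C : ℝ) - 1) < 1 →
        maxSurplus E u a (served A) + (if h < k then 1 else 0) ≤
          maxSurplus E u a (served A') := by
  rcases hstep with ⟨k, p, q, hp, hmin, hf⟩ | ⟨_, rfl⟩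
  · refine ⟨hp.isFeasible hf hA, k, Or.inr hp.lt_card, hp.card_reassigned_le hf, ?_⟩
    intro a h ha hsmall
    split_ifs with hk
    · obtain ⟨X, hX, hmax⟩ := exists_surplus_eq_maxSurplus E u a (served A)
      refine maxSurplus_insert hX hmax (c := c) (by simp [served, hp.start_unassigned]) ?_
        (IsAugmentingPath.served_subset hf) (hp.mem_served hf)
      intro s hs
      exact neighbor_of_forall_le_length hu hA ha hX hmax hp.start_unassigned
        (fun k' p' q' h' => hk.trans_le (hmin k' p' q' h')) hsmall hs
    · rw [add_zero]
      exact maxSurplus_mono E u a (IsAugmentingPath.served_subset hf)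
  -- Without an augmenting path nothing changes; with `k = 0` no growth is claimed.
  · exact ⟨hA, 0, Or.inl rfl, by simp, fun a h _ _ => by simp⟩

end

/-! ### Summation of path lengths. -/

theorem add_sum_le_last {n : ℕ} (F : Fin (n + 1) → ℝ) (d : Fin n → ℝ)
    (h : ∀ i, F i.castSucc + d i ≤ F i.succ) : F 0 + ∑ i, d i ≤ F (Fin.last n) := by
  induction n with
  | zero => simp
  | succ n ih =>
    have h1 := ih (fun i => F i.castSucc) (fun i => d i.castSucc) fun i => h i.castSucc
    have h2 := h (Fin.last n)
    rw [Fin.sum_univ_castSucc]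
    simp only [Fin.castSucc_zero, Fin.succ_last] at h1 h2
    linarith

/-- A sequence of at most `n` lengths below `n`, of which at most `n * log n / h` exceed `h`. -/
theorem sum_le_of_card_le {n : ℕ} (k : Fin n → ℕ) (hk : ∀ t, k t < n)
    (hcount : ∀ h : ℕ, 0 < h →
      ((Finset.univ.filter fun t => h < k t).card : ℝ) ≤ Real.log n / h * n) :
    ((∑ t, k t : ℕ) : ℝ) ≤ 7 * (n * Real.log n ^ 2) := by
  rcases Nat.lt_or_ge n 2 with hn | hn
  · have : ∑ t, k t = 0 := Finset.sum_eq_zero fun t _ => by have := hk t; omega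
    rw [this, Nat.cast_zero]
    positivity
  -- Layer-cake summation: `k t` is the number of `h` below it.
  have hsum : ∑ t, k t ≤ ∑ h ∈ Finset.range n, (Finset.univ.filter fun t => h < k t).card := by
    simp only [Finset.card_filter]
    rw [Finset.sum_comm]
    refine Finset.sum_le_sum fun t _ => ?_
    rw [← Finset.card_filter]
    have : (Finset.range n).filter (fun h => h < k t) = Finset.range (k t) := by
      ext h
      have := hk t
      simp only [Finset.mem_filter, Finset.mem_range]
      omega
    rw [this, Finset.card_range]
  obtain ⟨m, rfl⟩ : ∃ m, n = m + 1 := ⟨n - 1, by omega⟩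
  have hn0 : (0 : ℝ) ≤ ((m + 1 : ℕ) : ℝ) := Nat.cast_nonneg _
  set L := Real.log ((m + 1 : ℕ) : ℝ) with hL
  have hlog : 1 / 2 ≤ L := by
    have h1 : Real.log 2 ≤ L := Real.log_le_log (by norm_num) (by exact_mod_cast hn)
    linarith [Real.log_two_gt_d9]
  have hharm : ∑ h ∈ Finset.range m, (1 : ℝ) / ((h + 1 : ℕ) : ℝ) ≤ 1 + L := by
    have h1 := harmonic_le_one_add_log m
    have h2 : ((harmonic m : ℚ) : ℝ) = ∑ h ∈ Finset.range m, (1 : ℝ) / ((h + 1 : ℕ) : ℝ) := by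
      simp [harmonic]
    have h3 : Real.log (m : ℝ) ≤ L :=
      Real.log_le_log (by exact_mod_cast (by omega : 0 < m)) (by push_cast; linarith)
    linarith
  have hbound : ((∑ t, k t : ℕ) : ℝ) ≤
      L * ((m + 1 : ℕ) : ℝ) * (1 + L) + ((m + 1 : ℕ) : ℝ) := by
    refine le_trans (Nat.cast_le.2 hsum) ?_
    rw [Finset.sum_range_succ']
    push_cast [Nat.cast_sum]
    refine add_le_add ?_ ?_
    · refine le_trans (Finset.sum_le_sum fun h _ => hcount (h + 1) (Nat.succ_pos h)) ?_
      refine le_trans (le_of_eq ?_) (mul_le_mul_of_nonneg_left hharm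
        (mul_nonneg (by linarith) (by exact_mod_cast hn0)))
      push_cast
      rw [Finset.mul_sum]
      refine Finset.sum_congr rfl fun h _ => ?_
      ring
    · have := Finset.card_le_univ (Finset.univ.filter fun t => 0 < k t)
      rw [Fintype.card_fin] at this
      exact_mod_cast this
  -- The constant 7 comes from `L ^ 2 + L + 1 ≤ 7 * L ^ 2`, which is tight at `L = 1 / 2`.
  nlinarith [mul_nonneg hn0 (by nlinarith : 0 ≤ 6 * L ^ 2 - L - 1)]

/-! ### The bound for a whole run. -/

theorem IsSAPRun.isFeasible {n : ℕ} {S : Type*} [Fintype S] {E : Fin n → S → Prop} {u : S → ℕ}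
    {A : Fin (n + 1) → Assignment (Fin n) S} (hu : ∀ s, 0 < u s) (hA : IsSAPRun E u A)
    (t : Fin (n + 1)) : IsFeasible E u (A t) := by
  induction t using Fin.induction with
  | zero => exact ⟨fun c s h => by simp [hA.init c] at h, fun s => by simp [load, hA.init]⟩
  | succ t ih => exact (SAPStep.exists_length hu ih (hA.step t)).1

theorem IsSAPRun.reassignments_le {n : ℕ} {S : Type*} [Fintype S] {E : Fin n → S → Prop}
    {u : S → ℕ} {A : Fin (n + 1) → Assignment (Fin n) S} (hu : ∀ s, 0 < u s)
    (hA : IsSAPRun E u A) : (reassignments A : ℝ) ≤ 7 * (n * Real.log n ^ 2) := by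
  classical
  choose k hk hcard hgrow using fun t =>
    (SAPStep.exists_length hu (hA.isFeasible hu t.castSucc) (hA.step t)).2
  simp only [Fintype.card_fin] at hk hgrow
  have hkn : ∀ t, k t < n := fun t => (hk t).elim (fun h => h ▸ t.pos) id
  refine le_trans (Nat.cast_le.2 (?_ : reassignments A ≤ ∑ t, k t)) (sum_le_of_card_le k hkn ?_)
  · exact Finset.sum_le_sum fun t _ => hcard t
  intro h hh
  have hh' : (0 : ℝ) < h := by exact_mod_cast hh
  rcases Nat.eq_zero_or_pos n with rfl | hn
  · simp
  have hn' : (1 : ℝ) ≤ n := by exact_mod_cast hn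
  set ε := Real.log n / h with hε
  have hε0 : 0 ≤ ε := div_nonneg (Real.log_nonneg hn') hh'.le
  -- The potential with `a = 1 - ε` needs `ε ≤ 1`; otherwise the claimed count is at least `n` and
  -- holds trivially.
  rcases le_total ε 1 with h1 | h1
  · have hpow : (1 - ε) ^ h ≤ (n : ℝ)⁻¹ := by
      calc (1 - ε) ^ h ≤ Real.exp (-ε) ^ h :=
            pow_le_pow_left₀ (by linarith) (Real.one_sub_le_exp_neg ε) h
        _ = (n : ℝ)⁻¹ := by
            rw [← Real.exp_nat_mul, hε, mul_neg, mul_div_cancel₀ _ hh'.ne', Real.exp_neg,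
              Real.exp_log (by linarith)]
    have hsmall : (1 - ε) ^ h * ((n : ℝ) - 1) < 1 := by
      refine lt_of_le_of_lt (mul_le_mul_of_nonneg_right hpow (by linarith)) ?_
      rw [inv_mul_lt_iff₀ (by linarith)]
      linarith
    have hF := add_sum_le_last (fun t => maxSurplus E u (1 - ε) (served (A t)))
      (fun t => if h < k t then 1 else 0)
      fun t => hgrow t (1 - ε) h (by linarith) hsmall
    have hlast := (hA.isFeasible hu (Fin.last n)).maxSurplus_le (a := 1 - ε) (by linarith)
      (by linarith)
    have hzero := maxSurplus_nonneg E u (1 - ε) (served (A 0))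
    rw [Fintype.card_fin, sub_sub_cancel] at hlast
    simp only [Finset.sum_boole] at hF
    linarith
  · have h2 : ((Finset.univ.filter fun t => h < k t).card : ℝ) ≤ n := by
      have := Finset.card_le_univ (Finset.univ.filter fun t => h < k t)
      rw [Fintype.card_fin] at this
      exact_mod_cast this
    nlinarith

end CapacitatedAssignment

theorem theorem3 :
    ∃ K : ℝ, ∀ (n : ℕ) (S : Type*) [Finite S] (E : Fin n → S → Prop) (u : S → ℕ)
      (A : Fin (n + 1) → CapacitatedAssignment.Assignment (Fin n) S),
      (∀ s, 0 < u s) → CapacitatedAssignment.IsSAPRun E u A →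
        (CapacitatedAssignment.reassignments A : ℝ) ≤ K * (n * Real.log n ^ 2) := by
  refine ⟨7, fun n S _ E u A hu hA => ?_⟩
  have := Fintype.ofFinite S
  exact hA.reassignments_le hu
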